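/- Let $\mathcal H$ be a separable complex Hilbert space and let $H$ be an unbounded self-adjoint operator in $\mathcal H$. Then there exists a one-parameter family $\{U_t\}_{t\in\mathbb R}$ of pairwise distinct unitary operators on $\mathcal H$ such that $$\operatorname{dom} H\cap\operatorname{dom}(U_t^*HU_t)=\{0\}\qquad\text{for all } t\in\mathbb R .$$ Moreover, there exists a strongly continuous family $\{J_t\}_{t\in\mathbb R}$ of pairwise distinct fundamental symmetries (i.e. bounded operators on $\mathcal H$ that are both self-adjoint and unitary) such that $$\operatorname{dom} H\cap\operatorname{dom}(J_tHJ_t)=\{0\}\qquad\text{for all } t\in\mathbb R .$$ Here, for bounded operators $B,C$, the operator $BHC$ has its natural domain $\{x\in\mathcal H : Cx\in\operatorname{dom} H\}$, and strong continuity means that $t\mapsto J_tx$ is continuous for every $x\in\mathcal H$. -/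

import Mathlib

/-- The unbounded operator `B H C`, for `H` a partially defined operator and `B`, `C` bounded,
with its natural (maximal) domain `{x | C x ∈ dom H}` and action `x ↦ B (H (C x))`. -/
noncomputable def boundedSandwich {E : Type*} [NormedAddCommGroup E] [InnerProductSpace ℂ E]
    (B : E →L[ℂ] E) (H : E →ₗ.[ℂ] E) (C : E →L[ℂ] E) : E →ₗ.[ℂ] E where
  domain := H.domain.comap (C : E →ₗ[ℂ] E)
  toFun := (B : E →ₗ[ℂ] E) ∘ₗ H.toFun ∘ₗ (C : E →ₗ[ℂ] E).submoduleComap H.domain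

/-- A partially defined operator is unbounded if no constant bounds it on its domain. -/
def IsUnboundedOperator {E : Type*} [NormedAddCommGroup E] [InnerProductSpace ℂ E]
    (H : E →ₗ.[ℂ] E) : Prop :=
  ¬ ∃ C : ℝ, ∀ x : H.domain, ‖H x‖ ≤ C * ‖(x : E)‖

/-- A fundamental symmetry: a bounded operator that is both self-adjoint and unitary. -/
def IsFundamentalSymmetry {E : Type*} [NormedAddCommGroup E] [InnerProductSpace ℂ E]
    [CompleteSpace E] (J : E →L[ℂ] E) : Prop :=
  IsSelfAdjoint J ∧ J ∈ unitary (E →L[ℂ] E)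

open scoped InnerProductSpace

/-! It suffices to find one fundamental symmetry `J` such that `x` and `J x` both lie in `dom H`
only for `x = 0`; conjugating it by unitaries that preserve `dom H` gives a family serving both
claims.

Unboundedness and symmetry give an orthonormal sequence `g n = H (y n)` with `y n` geometrically
small, so `⟪g n, x⟫ = ⟪y n, H x⟫` decays geometrically for `x` in the domain
(`exists_orthonormal_decay`). Complete `g` to a basis arranged in columns indexed by `ℤ`
(`exists_total_grid`) and read each column as the Fourier basis of `L²` of the circle. Domain
vectors become sequences of real-analytic functions, and such a function is zero once it vanishes on
a nonempty open set.

Let `M` consist of the sequences vanishing on an open `U` whose complement has interior. Then `dom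
H` meets `M` and `Mᗮ` only in `0`, and the reflection in `M` is the required `J`. -/

theorem Complex.injective_exp_arctan_mul_I :
    Function.Injective fun t : ℝ => Complex.exp (Real.arctan t * Complex.I) := by
  intro t s h
  have h1 := congrArg Complex.im h
  simp only [Complex.exp_ofReal_mul_I_im] at h1
  refine Real.arctan_injective (Real.injOn_sin ?_ ?_ h1)
  · exact ⟨(Real.neg_pi_div_two_lt_arctan t).le, (Real.arctan_lt_pi_div_two t).le⟩
  · exact ⟨(Real.neg_pi_div_two_lt_arctan s).le, (Real.arctan_lt_pi_div_two s).le⟩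

/-! ### From one fundamental symmetry to a continuous injective family. -/

section PhaseTwist

variable {E : Type*} [NormedAddCommGroup E] [InnerProductSpace ℂ E]

/-- The operator multiplying the component along `e` by `u` and fixing the orthogonal complement,
when `e` is a unit vector. -/
noncomputable def phaseTwist (e : E) (u : ℂ) : E →L[ℂ] E :=
  1 + (u - 1) • InnerProductSpace.rankOne ℂ e e

theorem phaseTwist_apply (e : E) (u : ℂ) (x : E) :
    phaseTwist e u x = x + ((u - 1) * ⟪e, x⟫_ℂ) • e := by
  simp [phaseTwist, smul_smul]

theorem phaseTwist_mem {R : Submodule ℂ E} {e x : E} (he : e ∈ R) (u : ℂ) (hx : x ∈ R) :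
    phaseTwist e u x ∈ R := by
  rw [phaseTwist_apply]
  exact R.add_mem hx (R.smul_mem _ he)

theorem phaseTwist_phaseTwist {e : E} (he : ‖e‖ = 1) (u v : ℂ) (x : E) :
    phaseTwist e u (phaseTwist e v x) = phaseTwist e (u * v) x := by
  have h1 : ⟪e, e⟫_ℂ = 1 := by simp [inner_self_eq_norm_sq_to_K, he]
  simp only [phaseTwist_apply, inner_add_right, inner_smul_right, h1]
  module

theorem continuous_phaseTwist (e : E) : Continuous (phaseTwist e) := by
  unfold phaseTwist
  fun_prop

variable [CompleteSpace E]

theorem star_phaseTwist (e : E) (u : ℂ) : star (phaseTwist e u) = phaseTwist e (star u) := by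
  rw [ContinuousLinearMap.star_eq_adjoint, eq_comm, ContinuousLinearMap.eq_adjoint_iff]
  intro x y
  simp only [phaseTwist_apply, inner_add_left, inner_add_right, inner_smul_left, inner_smul_right,
    map_mul, inner_conj_symm, map_sub, map_one, RCLike.star_def, Complex.conj_conj]
  ring

theorem phaseTwist_mem_unitary {e : E} (he : ‖e‖ = 1) {u : ℂ} (hu : ‖u‖ = 1) :
    phaseTwist e u ∈ unitary (E →L[ℂ] E) := by
  have h1 : u * star u = 1 := by
    rw [RCLike.star_def, Complex.mul_conj, Complex.normSq_eq_norm_sq, hu]; simp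
  rw [Unitary.mem_iff, star_phaseTwist]
  constructor <;> ext x
  · simp only [mul_apply_eq_comp, phaseTwist_phaseTwist he, mul_comm _ u, h1]
    simp [phaseTwist]
  · simp only [mul_apply_eq_comp, phaseTwist_phaseTwist he, h1]
    simp [phaseTwist]

/-- Phase twists along `e ∈ R` are unitaries preserving `R`, so conjugating `J` by them keeps the
disjointness. The conjugates differ because the component of `J e` orthogonal to `e` picks up the
phase, and it is nonzero: otherwise `J e ∈ R`. -/
theorem exists_family_of_fundamentalSymmetry {R : Submodule ℂ E} {J : E →L[ℂ] E}
    (hJ : IsFundamentalSymmetry J) (hR : ∀ x ∈ R, J x ∈ R → x = 0) {e : E} (heR : e ∈ R)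
    (he : ‖e‖ = 1) :
    ∃ K : ℝ → (E →L[ℂ] E), Function.Injective K ∧ (∀ t, IsFundamentalSymmetry (K t)) ∧
      Continuous K ∧ ∀ t, ∀ x ∈ R, K t x ∈ R → x = 0 := by
  set u : ℝ → ℂ := fun t => Complex.exp (Real.arctan t * Complex.I) with hu
  have hun : ∀ t, ‖u t‖ = 1 := fun t => Complex.norm_exp_ofReal_mul_I _
  have huu : ∀ t, u t * star (u t) = 1 := fun t => by
    rw [RCLike.star_def, Complex.mul_conj, Complex.normSq_eq_norm_sq, hun]; simp
  have huc : Continuous u := by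
    rw [hu]
    have := Real.continuous_arctan
    fun_prop
  have hui : Function.Injective u := Complex.injective_exp_arctan_mul_I
  have hee : ⟪e, e⟫_ℂ = 1 := by simp [inner_self_eq_norm_sq_to_K, he]
  have hinv : ∀ t x, phaseTwist e (u t) (phaseTwist e (star (u t)) x) = x := fun t x => by
    rw [phaseTwist_phaseTwist he, huu, phaseTwist_apply]; simp
  have hinv' : ∀ t x, phaseTwist e (star (u t)) (phaseTwist e (u t) x) = x := fun t x => by
    rw [phaseTwist_phaseTwist he, mul_comm, huu, phaseTwist_apply]; simp
  refine ⟨fun t => phaseTwist e (u t) * J * phaseTwist e (star (u t)), ?_, ?_, ?_, ?_⟩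
  · intro t s hts
    by_contra hne
    have hval : ∀ t, (phaseTwist e (u t) * J * phaseTwist e (star (u t))) e =
        star (u t) • (J e - ⟪e, J e⟫_ℂ • e) + ⟪e, J e⟫_ℂ • e := fun t => by
      have h1 : phaseTwist e (star (u t)) e = star (u t) • e := by
        rw [phaseTwist_apply, hee]; module
      simp only [mul_apply_eq_comp, h1, map_smul]
      rw [phaseTwist_apply]
      have h2 : star (u t) * (u t - 1) = 1 - star (u t) := by rw [mul_sub, mul_comm, huu]; ring
      rw [smul_add, smul_smul, ← mul_assoc, h2]
      module
    have h3 := congrArg (fun T : E →L[ℂ] E => T e) hts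
    simp only [hval, add_left_inj] at h3
    have h4 : (star (u t) - star (u s)) • (J e - ⟪e, J e⟫_ℂ • e) = 0 := by
      rw [sub_smul, h3, sub_self]
    rcases smul_eq_zero.1 h4 with h5 | h5
    · exact hne (hui (star_injective (sub_eq_zero.1 h5)))
    · have h6 : J e ∈ R := by
        rw [sub_eq_zero.1 h5]; exact R.smul_mem _ heR
      have h7 := hR e heR h6
      simp [h7] at he
  · intro t
    have hs : star (phaseTwist e (u t)) = phaseTwist e (star (u t)) := star_phaseTwist _ _
    refine ⟨?_, mul_mem (mul_mem (phaseTwist_mem_unitary he (hun t)) hJ.2)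
      (phaseTwist_mem_unitary he (by simp [hun]))⟩
    simp only [← hs]
    exact hJ.1.conjugate _
  · have h1 : Continuous fun t => phaseTwist e (u t) := (continuous_phaseTwist e).comp huc
    have h2 : Continuous fun t => phaseTwist e (star (u t)) :=
      (continuous_phaseTwist e).comp huc.star
    exact (h1.mul continuous_const).mul h2
  · intro t x hx hKx
    have h1 := phaseTwist_mem heR (star (u t)) hKx
    simp only [mul_apply_eq_comp, hinv'] at h1
    have h2 := hR _ (phaseTwist_mem heR (star (u t)) hx) h1
    rw [← hinv t x, h2, map_zero]

end PhaseTwist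

/-! ### Orthonormal sequences in the range of an unbounded symmetric operator. -/

section UnboundedSymmetric

open Filter Topology

variable {E : Type*} [NormedAddCommGroup E] [InnerProductSpace ℂ E]

theorem IsUnboundedOperator.exists_seq {H : E →ₗ.[ℂ] E} (hunb : IsUnboundedOperator H) :
    ∃ y : ℕ → H.domain, (∀ n, ‖H (y n)‖ = 1) ∧ Tendsto (fun n => (y n : E)) atTop (𝓝 0) := by
  have key : ∀ n : ℕ, ∃ y : H.domain, ‖H y‖ = 1 ∧ ‖(y : E)‖ ≤ 1 / ((n : ℝ) + 1) := by
    intro n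
    simp only [IsUnboundedOperator, not_exists, not_forall, not_le] at hunb
    obtain ⟨x, hx⟩ := hunb ((n : ℝ) + 1)
    have hpos : 0 < ‖H x‖ := lt_of_le_of_lt (by positivity) hx
    refine ⟨((‖H x‖⁻¹ : ℝ) : ℂ) • x, ?_, ?_⟩
    · rw [H.map_smul, norm_smul, Complex.norm_real, norm_inv, norm_norm]
      exact inv_mul_cancel₀ hpos.ne'
    · rw [Submodule.coe_smul, norm_smul, Complex.norm_real, norm_inv, norm_norm,
        inv_mul_le_iff₀ hpos, mul_one_div, le_div_iff₀ (by positivity), mul_comm]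
      exact hx.le
  choose y hy hy' using key
  exact ⟨y, hy, squeeze_zero_norm hy' tendsto_one_div_add_atTop_nhds_zero_nat⟩

/-- For `w` in the domain, `⟪w, H (y n)⟫ = ⟪H w, y n⟫ → 0`; density and the bound on `H (y n)`
extend this to every `v`. -/
theorem LinearPMap.IsFormalAdjoint.tendsto_inner_zero {H : E →ₗ.[ℂ] E}
    (hsymm : H.IsFormalAdjoint H) (hdense : Dense (H.domain : Set E)) {y : ℕ → H.domain}
    (hy : ∀ n, ‖H (y n)‖ ≤ 1) (hy0 : Tendsto (fun n => (y n : E)) atTop (𝓝 0)) (v : E) :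
    Tendsto (fun n => ⟪v, H (y n)⟫_ℂ) atTop (𝓝 0) := by
  rw [Metric.tendsto_atTop]
  intro ε hε
  obtain ⟨w, hw, hvw⟩ := Metric.dense_iff.1 hdense v (ε / 2) (half_pos hε)
  have h1 : Tendsto (fun n => ⟪H ⟨w, hvw⟩, (y n : E)⟫_ℂ) atTop (𝓝 0) := by
    simpa using (tendsto_const_nhds (x := H ⟨w, hvw⟩)).inner (𝕜 := ℂ) hy0
  obtain ⟨N, hN⟩ := Metric.tendsto_atTop.1 h1 (ε / 2) (half_pos hε)
  refine ⟨N, fun n hn => ?_⟩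
  have h2 := hN n hn
  rw [dist_zero_right] at h2 ⊢
  have h3 : ⟪v, H (y n)⟫_ℂ = ⟪v - w, H (y n)⟫_ℂ + ⟪H ⟨w, hvw⟩, (y n : E)⟫_ℂ := by
    rw [inner_sub_left, hsymm ⟨w, hvw⟩ (y n)]; ring
  rw [h3]
  have h4 : ‖⟪v - w, H (y n)⟫_ℂ‖ ≤ ‖v - w‖ := (norm_inner_le_norm _ _).trans
    (mul_le_of_le_one_right (norm_nonneg _) (hy n))
  have h5 : ‖v - w‖ < ε / 2 := by rwa [Metric.mem_ball, dist_comm, dist_eq_norm] at hw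
  calc _ ≤ _ := norm_add_le _ _
    _ < ε := by linarith

theorem LinearPMap.IsFormalAdjoint.exists_unit_image_small {H : E →ₗ.[ℂ] E}
    (hsymm : H.IsFormalAdjoint H) (hdense : Dense (H.domain : Set E))
    (hunb : IsUnboundedOperator H) (s : Finset H.domain) {ε : ℝ} (hε : 0 < ε) :
    ∃ y : H.domain, ‖H y‖ = 1 ∧ ‖(y : E)‖ ≤ ε ∧ ∀ x ∈ s, ⟪H x, H y⟫_ℂ = 0 := by
  obtain ⟨y, hy1, hy0⟩ := hunb.exists_seq
  have hweak := hsymm.tendsto_inner_zero hdense (fun n => (hy1 n).le) hy0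
  set S : Submodule ℂ H.domain := Submodule.span ℂ s
  have : FiniteDimensional ℂ S := FiniteDimensional.span_finset ℂ s
  set F : Submodule ℂ E := S.map H.toFun
  let f := stdOrthonormalBasis ℂ F
  have hF : ∀ j, ∃ z : H.domain, H z = f j := fun j => by
    obtain ⟨z, -, hz⟩ := (f j).2
    exact ⟨z, hz⟩
  choose z hz using hF
  -- A preimage under `H` of the projection of `H (y n)` onto `F`. Its finitely many coefficients
  -- tend to `0`, so subtracting it from `y n` costs little in norm, before and after applying `H`.
  set c : ℕ → H.domain := fun n => ∑ j, ⟪(f j : E), H (y n)⟫_ℂ • z j with hc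
  have hHsum : ∀ n, H (c n) = ∑ j, ⟪(f j : E), H (y n)⟫_ℂ • H (z j) := fun n =>
    (map_sum H.toFun _ _).trans (Finset.sum_congr rfl fun j _ => H.map_smul _ _)
  have hHc : ∀ n, H (c n) = F.starProjection (H (y n)) := fun n => by
    rw [Submodule.starProjection_apply, ← f.sum_repr' (F.orthogonalProjectionOnto (H (y n)))]
    rw [hHsum, Submodule.coe_sum]
    refine Finset.sum_congr rfl fun j _ => ?_
    rw [Submodule.coe_smul, hz, Submodule.inner_orthogonalProjectionOnto_eq_of_mem_left]
  have hc0 : Tendsto (fun n => (c n : E)) atTop (𝓝 0) := by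
    simpa [hc] using
      tendsto_finsetSum Finset.univ fun j _ => (hweak (f j)).smul_const (z j : E)
  have hHc0 : Tendsto (fun n => H (c n)) atTop (𝓝 0) := by
    simpa [hHsum] using
      tendsto_finsetSum Finset.univ fun j _ => (hweak (f j)).smul_const (H (z j))
  have hd0 : Tendsto (fun n => ((y n - c n : H.domain) : E)) atTop (𝓝 0) := by
    simpa using hy0.sub hc0
  have e1 := (tendsto_zero_iff_norm_tendsto_zero.1 hHc0).eventually (gt_mem_nhds one_half_pos)
  have e2 := (tendsto_zero_iff_norm_tendsto_zero.1 hd0).eventually (gt_mem_nhds (half_pos hε))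
  obtain ⟨n, h1, h2⟩ := (e1.and e2).exists
  have h3 : 1 / 2 ≤ ‖H (y n - c n)‖ := by
    rw [H.map_sub]
    have := norm_sub_norm_le (H (y n)) (H (c n))
    rw [hy1] at this
    linarith
  have hpos : 0 < ‖H (y n - c n)‖ := by linarith
  refine ⟨((‖H (y n - c n)‖⁻¹ : ℝ) : ℂ) • (y n - c n), ?_, ?_, ?_⟩
  · rw [H.map_smul, norm_smul, Complex.norm_real, norm_inv, norm_norm]
    exact inv_mul_cancel₀ hpos.ne'
  · rw [Submodule.coe_smul, norm_smul, Complex.norm_real, norm_inv, norm_norm,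
      inv_mul_le_iff₀ hpos]
    nlinarith
  · intro x hx
    have hxF : H x ∈ F := ⟨x, Submodule.subset_span hx, rfl⟩
    rw [H.map_smul, inner_smul_right, H.map_sub, hHc,
      Submodule.inner_right_of_mem_orthogonal hxF (F.sub_starProjection_mem_orthogonal _), mul_zero]

/-- An unbounded symmetric operator has an orthonormal sequence in its range along which the
coefficients of any vector of the domain decay geometrically. -/
theorem LinearPMap.IsFormalAdjoint.exists_orthonormal_decay {H : E →ₗ.[ℂ] E}
    (hsymm : H.IsFormalAdjoint H) (hdense : Dense (H.domain : Set E))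
    (hunb : IsUnboundedOperator H) {r : ℝ} (hr : 0 < r) :
    ∃ g : ℕ → E, Orthonormal ℂ g ∧
      ∀ x ∈ H.domain, ∃ C : ℝ, ∀ n, ‖⟪g n, x⟫_ℂ‖ ≤ C * r ^ n := by
  classical
  obtain ⟨y, hP, hy⟩ := exists_seq_of_forall_finset_exists (fun y : H.domain => ‖H y‖ = 1)
    (fun x y => ⟪H x, H y⟫_ℂ = 0 ∧ ‖(y : E)‖ ≤ r * ‖(x : E)‖) (by
      intro s hs
      have hne : ∀ x ∈ s, 0 < ‖(x : E)‖ := fun x hx => by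
        refine norm_pos_iff.2 fun h => ?_
        have h1 := hs x hx
        rw [(Subtype.ext h : x = 0), H.map_zero] at h1
        simp at h1
      obtain ⟨ε, hε, hεs⟩ : ∃ ε : ℝ, 0 < ε ∧ ∀ x ∈ s, ε ≤ r * ‖(x : E)‖ := by
        rcases s.eq_empty_or_nonempty with rfl | hsn
        · exact ⟨1, one_pos, by simp⟩
        · obtain ⟨x, hx, hmin⟩ := s.exists_min_image (fun x => r * ‖(x : E)‖) hsn
          exact ⟨_, mul_pos hr (hne x hx), hmin⟩
      obtain ⟨y, h1, h2, h3⟩ := hsymm.exists_unit_image_small hdense hunb s hε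
      exact ⟨y, h1, fun x hx => ⟨h3 x hx, h2.trans (hεs x hx)⟩⟩)
  refine ⟨fun n => H (y n), ⟨hP, fun i j hij => ?_⟩, fun x hx => ⟨‖(y 0 : E)‖ * ‖H ⟨x, hx⟩‖, ?_⟩⟩
  · rcases lt_or_gt_of_ne hij with h | h
    · exact (hy i j h).1
    · exact inner_eq_zero_symm.1 (hy j i h).1
  · have hbound : ∀ n, ‖(y n : E)‖ ≤ ‖(y 0 : E)‖ * r ^ n := fun n => by
      induction n with
      | zero => simp
      | succ n ih =>
        calc _ ≤ _ := (hy n (n + 1) n.lt_succ_self).2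
          _ ≤ r * (‖(y 0 : E)‖ * r ^ n) := by gcongr
          _ = _ := by ring
    intro n
    have h1 : ⟪H (y n), x⟫_ℂ = ⟪(y n : E), H ⟨x, hx⟩⟫_ℂ := hsymm (y n) ⟨x, hx⟩
    rw [h1]
    calc _ ≤ _ := norm_inner_le_norm _ _
      _ ≤ ‖(y 0 : E)‖ * r ^ n * ‖H ⟨x, hx⟩‖ := by gcongr; exact hbound n
      _ = _ := by ring

end UnboundedSymmetric

/-! ### Arranging an orthonormal basis in a grid. -/

section OrthonormalGrid

variable {E : Type*} [NormedAddCommGroup E] [InnerProductSpace ℂ E]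

theorem Orthonormal.countable [TopologicalSpace.SeparableSpace E] {ι : Type*} {v : ι → E}
    (hv : Orthonormal ℂ v) : Countable ι := by
  have hdist : ∀ i j, i ≠ j → 1 ≤ dist (v i) (v j) := fun i j hij => by
    have h1 := norm_sub_sq (𝕜 := ℂ) (v i) (v j)
    rw [hv.1, hv.1, hv.2 hij, map_zero] at h1
    rw [dist_eq_norm]
    nlinarith [norm_nonneg (v i - v j)]
  refine Pairwise.countable_of_isOpen_disjoint (s := fun i => Metric.ball (v i) (1 / 2)) ?_
    (fun i => Metric.isOpen_ball) fun i => ⟨v i, Metric.mem_ball_self (by norm_num)⟩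
  exact fun i j hij => Metric.ball_disjoint_ball (by linarith [hdist i j hij])

/-- Any orthonormal sequence `g` in a separable Hilbert space can be completed and rearranged to
a total orthonormal family indexed by a grid, so that `|k|` is at most the index in `g` of
the vector at `(i, k)` unless `k = 0`. -/
theorem Orthonormal.exists_total_grid [CompleteSpace E] [TopologicalSpace.SeparableSpace E]
    {g : ℕ → E} (hg : Orthonormal ℂ g) :
    ∃ v : ℕ × ℤ → E, Orthonormal ℂ v ∧ (Submodule.span ℂ (Set.range v))ᗮ = ⊥ ∧
      ∀ (i : ℕ) (k : ℤ), k ≠ 0 → ∃ n : ℕ, |k| ≤ (n : ℤ) ∧ v (i, k) = g n := by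
  classical
  obtain ⟨w, b, hsw, hb⟩ := hg.toSubtypeRange.exists_hilbertBasis_extension
  have hw : Orthonormal ℂ ((↑) : w → E) := hb ▸ b.orthonormal
  have hwc : Countable w := hw.countable
  set p : ℕ × ℤ → ℕ := fun q => Nat.pair q.1 (Equiv.intEquivNat q.2) with hp
  have hpinj : Function.Injective p := fun q q' h => by
    rw [hp, Nat.pair_eq_pair] at h
    exact Prod.ext h.1 (Equiv.intEquivNat.injective h.2)
  have hple : ∀ i k, |k| ≤ (p (i, k) : ℤ) := fun i k => by
    have h1 : |k| ≤ (Equiv.intEquivNat k : ℤ) := by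
      rcases k with n | n
      · change |(n : ℤ)| ≤ ((2 * n : ℕ) : ℤ)
        rw [Nat.abs_cast]; push_cast; omega
      · change |Int.negSucc n| ≤ ((2 * n + 1 : ℕ) : ℤ)
        rw [Int.negSucc_eq, abs_neg, abs_of_nonneg (by positivity)]; push_cast; omega
    exact h1.trans (by exact_mod_cast Nat.right_le_pair _ _)
  set G : Set E := {x | ∃ (i : ℕ) (k : ℤ), k ≠ 0 ∧ x = g (p (i, k))} with hG
  -- The basis vectors left over for the entries `k = 0`; infinitely many, since each `g (p (i, 0))`
  -- is among them.
  set B : Set E := w \ G with hB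
  have hBc : Countable B := (Set.countable_coe_iff.1 hwc).mono Set.sdiff_subset
  have hBi : Infinite B := by
    refine Infinite.of_injective (fun i : ℕ => (⟨g (p (i, 0)), hsw ⟨_, rfl⟩, ?_⟩ : B)) ?_
    · rintro ⟨i', k, hk, h⟩
      exact hk (congrArg Prod.snd (hpinj (hg.linearIndependent.injective h))).symm
    · intro i j h
      have h1 := hpinj (hg.linearIndependent.injective (congrArg Subtype.val h))
      exact congrArg Prod.fst h1
  obtain ⟨hden⟩ := nonempty_denumerable B
  let e : ℕ ≃ B := (Denumerable.eqv B).symm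
  let v : ℕ × ℤ → E := fun q => if q.2 = 0 then (e q.1 : E) else g (p q)
  have hv0 : ∀ i, v (i, 0) = e i := fun i => if_pos rfl
  have hv1 : ∀ i k, k ≠ 0 → v (i, k) = g (p (i, k)) := fun i k hk => if_neg hk
  have hvw : ∀ q, v q ∈ w := by
    rintro ⟨i, k⟩
    by_cases hk : k = 0
    · subst hk; rw [hv0]; exact (e i).2.1
    · rw [hv1 i k hk]; exact hsw ⟨_, rfl⟩
  have hvinj : Function.Injective v := by
    rintro ⟨i, k⟩ ⟨i', k'⟩ h
    by_cases hk : k = 0 <;> by_cases hk' : k' = 0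
    · subst hk hk'
      rw [hv0, hv0] at h
      rw [e.injective (Subtype.ext h)]
    · subst hk
      rw [hv0, hv1 _ _ hk'] at h
      exact absurd ⟨i', k', hk', h⟩ (e i).2.2
    · subst hk'
      rw [hv0, hv1 _ _ hk] at h
      exact absurd ⟨i, k, hk, h.symm⟩ (e i').2.2
    · rw [hv1 _ _ hk, hv1 _ _ hk'] at h
      exact hpinj (hg.linearIndependent.injective h)
  have hrange : Set.range v = w := by
    refine Set.Subset.antisymm (Set.range_subset_iff.2 hvw) fun x hx => ?_
    by_cases hxG : x ∈ G
    · obtain ⟨i, k, hk, rfl⟩ := hxG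
      exact ⟨(i, k), hv1 i k hk⟩
    · exact ⟨(e.symm ⟨x, hx, hxG⟩, 0), by rw [hv0, e.apply_symm_apply]⟩
  refine ⟨v, ?_, ?_, fun i k hk => ⟨p (i, k), hple i k, hv1 i k hk⟩⟩
  · exact hw.comp (fun q => ⟨v q, hvw q⟩) fun q q' h => hvinj (congrArg Subtype.val h)
  · have h1 := b.dense_span
    rw [hb, Subtype.range_coe] at h1
    rw [hrange, ← Submodule.topologicalClosure_eq_top_iff, h1]

end OrthonormalGrid

/-! ### Unique continuation for rapidly decaying Fourier series. -/

section AnalyticFourier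

open MeasureTheory AddCircle Filter Topology

theorem summable_exp_neg_abs_int : Summable fun k : ℤ => Real.exp (-|(k : ℝ)|) := by
  refine Summable.of_nat_of_neg ?_ ?_ <;>
  · simpa using Real.summable_exp_neg_nat

theorem Complex.norm_exp_two_pi_I_int_mul_le (k : ℤ) {z : ℂ} (hz : |z.im| ≤ 1) :
    ‖Complex.exp (2 * Real.pi * Complex.I * k * z)‖ ≤ Real.exp (7 * |(k : ℝ)|) := by
  rw [Complex.norm_exp]
  refine Real.exp_le_exp.2 ?_
  have h1 : (2 * Real.pi * Complex.I * k * z).re = -(2 * Real.pi * (k * z.im)) := by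
    simp [Complex.mul_re, Complex.mul_im]; ring
  rw [h1]
  have h2 : |(k : ℝ) * z.im| ≤ |(k : ℝ)| := by
    rw [abs_mul]; exact mul_le_of_le_one_right (abs_nonneg _) hz
  have h3 := neg_abs_le ((k : ℝ) * z.im)
  nlinarith [Real.pi_lt_d2, Real.pi_pos, abs_nonneg (k : ℝ)]

theorem isPreconnected_abs_im_lt_one : IsPreconnected {z : ℂ | |z.im| < 1} := by
  have : {z : ℂ | |z.im| < 1} = Complex.imLm ⁻¹' Set.Ioo (-1) 1 := by
    ext z; simp [abs_lt]
  rw [this]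
  exact ((convex_Ioo _ _).linear_preimage Complex.imLm).isPreconnected

/-- A Fourier series with fast decaying coefficients extends to a strip, so it vanishes if it
vanishes on a nonempty open set. -/
theorem tsum_fourier_eq_zero_of_eqOn_open {c : ℤ → ℂ} {C : ℝ}
    (hc : ∀ k, ‖c k‖ ≤ C * Real.exp (-8 * |(k : ℝ)|)) {U : Set UnitAddCircle} (hU : IsOpen U)
    (hUn : U.Nonempty) (h0 : ∀ x ∈ U, ∑' k, c k * fourier k x = 0) (x : UnitAddCircle) :
    ∑' k, c k * fourier k x = 0 := by
  set S : Set ℂ := {z | |z.im| < 1} with hS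
  have hSo : IsOpen S := isOpen_lt (by fun_prop) continuous_const
  set F : ℂ → ℂ := fun z => ∑' k : ℤ, c k * Complex.exp (2 * Real.pi * Complex.I * k * z) with hF
  have hdiff : DifferentiableOn ℂ F S := by
    refine Complex.differentiableOn_tsum_of_summable_norm
      (u := fun k : ℤ => C * Real.exp (-|(k : ℝ)|)) (summable_exp_neg_abs_int.mul_left C)
      (fun k => by fun_prop) hSo fun k z hz => ?_
    rw [norm_mul]
    -- Since `2π < 7`, decay rate `8` leaves the summable factor `exp (-|k|)` on the strip.
    calc _ ≤ C * Real.exp (-8 * |(k : ℝ)|) * Real.exp (7 * |(k : ℝ)|) :=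
          mul_le_mul (hc k) (Complex.norm_exp_two_pi_I_int_mul_le k (le_of_lt hz)) (norm_nonneg _)
            ((norm_nonneg _).trans (hc k))
      _ = _ := by rw [mul_assoc, ← Real.exp_add]; ring_nf
  have hreal : ∀ t : ℝ, F t = ∑' k, c k * fourier k (t : UnitAddCircle) := fun t => by
    simp only [hF, fourier_coe_apply, Complex.ofReal_one, div_one]
  obtain ⟨y, hy⟩ := hUn
  obtain ⟨s, rfl⟩ := QuotientAddGroup.mk_surjective y
  have hev : ∀ᶠ t : ℝ in 𝓝 s, F t = 0 := by
    filter_upwards [(hU.preimage (AddCircle.continuous_mk' (1 : ℝ))).mem_nhds hy] with t ht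
    rw [hreal]; exact h0 _ ht
  have hfreq : ∃ᶠ z in 𝓝[≠] (s : ℂ), F z = 0 := by
    have hmap : Tendsto (fun t : ℝ => (t : ℂ)) (𝓝[≠] s) (𝓝[≠] (s : ℂ)) :=
      Complex.continuous_ofReal.continuousWithinAt.tendsto_nhdsWithin
        fun t ht h => ht (Complex.ofReal_injective h)
    exact hmap.frequently (hev.filter_mono nhdsWithin_le_nhds).frequently
  have hzero := (hdiff.analyticOnNhd hSo).eqOn_zero_of_preconnected_of_frequently_eq_zero
    isPreconnected_abs_im_lt_one (z₀ := (s : ℂ)) (by simp [hS]) hfreq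
  obtain ⟨t, rfl⟩ := QuotientAddGroup.mk_surjective x
  exact (hreal t).symm.trans (hzero (by simp [hS]))

/-- The Fourier series converges uniformly to a continuous representative, for which vanishing a.e.
on an open set is pointwise vanishing. -/
theorem fourierLp_eq_zero_of_ae_eq_zero_on_open {f : Lp ℂ 2 (haarAddCircle (T := (1 : ℝ)))}
    {C : ℝ} (hc : ∀ k, ‖fourierBasis.repr f k‖ ≤ C * Real.exp (-8 * |(k : ℝ)|))
    {U : Set UnitAddCircle} (hU : IsOpen U) (hUn : U.Nonempty)
    (h0 : ∀ᵐ x ∂haarAddCircle, x ∈ U → f x = 0) : f = 0 := by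
  set c : ℤ → ℂ := fun k => fourierBasis.repr f k with hcdef
  have hC : 0 ≤ C := by simpa using (norm_nonneg _).trans (hc 0)
  have hsum : Summable fun k => c k • (fourier k : C(UnitAddCircle, ℂ)) := by
    refine Summable.of_norm_bounded (summable_exp_neg_abs_int.mul_left C) fun k => ?_
    rw [norm_smul, fourier_norm, mul_one]
    refine (hc k).trans (mul_le_mul_of_nonneg_left (Real.exp_le_exp.2 ?_) hC)
    linarith [abs_nonneg (k : ℝ)]
  set h : C(UnitAddCircle, ℂ) := ∑' k, c k • fourier k with hh
  have hf : ContinuousMap.toLp 2 haarAddCircle ℂ h = f := by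
    have h1 := (ContinuousMap.toLp (E := ℂ) 2 (haarAddCircle (T := (1 : ℝ))) ℂ).hasSum hsum.hasSum
    have h2 := hasSum_fourier_series_L2 f
    simp only [← fourierBasis_repr] at h2
    refine h1.unique ?_
    convert h2 using 2 with k
    exact map_smul _ _ _
  have hpt : ∀ x, h x = ∑' k, c k * fourier k x := fun x => by
    have h1 := (ContinuousMap.evalCLM ℂ x).hasSum hsum.hasSum
    exact h1.tsum_eq.symm
  have hfh : f =ᵐ[haarAddCircle] h := hf ▸ ContinuousMap.coeFn_toLp haarAddCircle h
  have hU0 : ∀ x ∈ U, h x = 0 := by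
    have h1 : h =ᵐ[haarAddCircle.restrict U] (fun _ => (0 : ℂ)) := by
      rw [Filter.EventuallyEq, ae_restrict_iff' hU.measurableSet]
      filter_upwards [h0, hfh] with x hx1 hx2 hx
      rw [← hx2, hx1 hx]
    exact Measure.eqOn_open_of_ae_eq h1 hU h.continuous.continuousOn continuousOn_const
  have hzero : h = 0 := by
    ext x
    rw [hpt]
    exact tsum_fourier_eq_zero_of_eqOn_open hc hU hUn (fun x hx => (hpt x).symm.trans (hU0 x hx)) x
  rw [← hf, hzero, map_zero]

end AnalyticFourier

/-! ### Functions supported on a set and their orthogonal complements. -/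

section Vanishing

open MeasureTheory

variable {X : Type*} [MeasurableSpace X]

/-- The square integrable functions vanishing almost everywhere on a set. -/
def lpVanishingOn (μ : Measure X) (A : Set X) : Submodule ℂ (Lp ℂ 2 μ) where
  carrier := {f | ∀ᵐ x ∂μ, x ∈ A → f x = 0}
  zero_mem' := by
    filter_upwards [Lp.coeFn_zero ℂ 2 μ] with x hx _
    rw [hx]; rfl
  add_mem' {f g} hf hg := by
    filter_upwards [hf, hg, Lp.coeFn_add f g] with x h1 h2 h3 hx
    rw [h3, Pi.add_apply, h1 hx, h2 hx, add_zero]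
  smul_mem' c f hf := by
    filter_upwards [hf, Lp.coeFn_smul c f] with x h1 h2 hx
    rw [h2, Pi.smul_apply, h1 hx, smul_zero]

variable {μ : Measure X} {A : Set X}

theorem mem_lpVanishingOn {f : Lp ℂ 2 μ} : f ∈ lpVanishingOn μ A ↔ ∀ᵐ x ∂μ, x ∈ A → f x = 0 :=
  Iff.rfl

theorem lpVanishingOn_isOrtho_compl : lpVanishingOn μ A ⟂ lpVanishingOn μ Aᶜ := by
  rw [Submodule.isOrtho_iff_inner_eq]
  intro f hf g hg
  rw [L2.inner_def]
  refine integral_eq_zero_of_ae ?_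
  filter_upwards [mem_lpVanishingOn.1 hf, mem_lpVanishingOn.1 hg] with x h1 h2
  by_cases hx : x ∈ A
  · simp [h1 hx]
  · simp [h2 hx]

/-- Test `f` against its own truncation to `A`. -/
theorem orthogonal_lpVanishingOn_compl_le (hA : MeasurableSet A) :
    (lpVanishingOn μ Aᶜ)ᗮ ≤ lpVanishingOn μ A := by
  intro f hf
  set h : Lp ℂ 2 μ := ((Lp.memLp f).indicator hA).toLp _ with hh
  have hcoe : h =ᵐ[μ] A.indicator f := MemLp.coeFn_toLp _
  have hmem : h ∈ lpVanishingOn μ Aᶜ := by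
    rw [mem_lpVanishingOn]
    filter_upwards [hcoe] with x hx hxA
    rw [hx, Set.indicator_of_notMem hxA]
  have h1 : ⟪h, h⟫_ℂ = ⟪h, f⟫_ℂ := by
    rw [L2.inner_def, L2.inner_def]
    refine integral_congr_ae ?_
    filter_upwards [hcoe] with x hx
    by_cases hxA : x ∈ A <;> simp [hx, hxA]
  rw [hf h hmem, inner_self_eq_zero] at h1
  rw [h1] at hcoe
  rw [mem_lpVanishingOn]
  filter_upwards [hcoe, Lp.coeFn_zero ℂ 2 μ] with x hx hx0 hxA
  rw [hx0, Set.indicator_of_mem hxA] at hx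
  exact hx.symm

end Vanishing

/-! ### Construction of the reflection. -/

section ExistsSymmetry

variable {E : Type*} [NormedAddCommGroup E] [InnerProductSpace ℂ E] [CompleteSpace E]

/-- The reflection in a closed subspace `M` moves every nonzero vector of `R` out of `R` as soon as
`R` has trivial intersection with `M` and with its orthogonal complement. -/
theorem exists_fundamentalSymmetry_of_disjoint {R M : Submodule ℂ E} [M.HasOrthogonalProjection]
    (h1 : ∀ x ∈ R, x ∈ M → x = 0) (h2 : ∀ x ∈ R, x ∈ Mᗮ → x = 0) :
    ∃ J : E →L[ℂ] E, IsFundamentalSymmetry J ∧ ∀ x ∈ R, J x ∈ R → x = 0 := by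
  have hP : IsStarProjection M.starProjection := isStarProjection_starProjection
  refine ⟨2 * M.starProjection - 1, ⟨?_, hP.two_mul_sub_one_mem_unitary⟩, fun x hx hJx => ?_⟩
  · rw [two_mul]
    exact (hP.isSelfAdjoint.add hP.isSelfAdjoint).sub (IsSelfAdjoint.one _)
  -- The projection is half the sum of `x` and `J x`.
  · have hPx : M.starProjection x ∈ R := by
      have h3 := R.smul_mem (2⁻¹ : ℂ) (R.add_mem hx hJx)
      convert h3 using 1
      rw [two_mul]
      simp only [sub_apply, add_apply, one_apply_eq_self]
      module
    have h3 := h1 _ hPx (Submodule.starProjection_apply_mem _ _)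
    have h4 := M.sub_starProjection_mem_orthogonal x
    rw [h3, sub_zero] at h4
    exact h2 x hx h4

/-- Gluing along a family of mutually orthogonal isometric copies of `G`: if `L` and `L'` are
orthogonal and no nonzero vector of `R` has all its components in `Lᗮ`, or all in `L'ᗮ`, then `R`
can be moved off itself by a fundamental symmetry. -/
theorem exists_fundamentalSymmetry_of_orthogonalFamily {G : Type*} [NormedAddCommGroup G]
    [InnerProductSpace ℂ G] [CompleteSpace G] {ι : Type*} {V : ι → G →ₗᵢ[ℂ] E}
    (hV : OrthogonalFamily ℂ (fun _ => G) V) {L L' : Submodule ℂ G} (hLL' : L ⟂ L')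
    {R : Submodule ℂ E}
    (h : ∀ x ∈ R, (∀ i, ∀ y ∈ L, ⟪V i y, x⟫_ℂ = 0) → x = 0)
    (h' : ∀ x ∈ R, (∀ i, ∀ y ∈ L', ⟪V i y, x⟫_ℂ = 0) → x = 0) :
    ∃ J : E →L[ℂ] E, IsFundamentalSymmetry J ∧ ∀ x ∈ R, J x ∈ R → x = 0 := by
  refine exists_fundamentalSymmetry_of_disjoint (M := (⨆ i, L.map (V i).toLinearMap)ᗮ)
    (fun x hx hxM => h x hx fun i y hy => ?_) (fun x hx hxM => h' x hx fun i y hy => ?_)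
  · exact hxM _ (Submodule.mem_iSup_of_mem i ⟨y, hy, rfl⟩)
  · refine hxM _ ?_
    have hle : (⨆ j, L.map (V j).toLinearMap) ≤ (Submodule.span ℂ {V i y})ᗮ := by
      refine iSup_le fun j => ?_
      rintro _ ⟨z, hz, rfl⟩
      rw [Submodule.mem_orthogonal_singleton_iff_inner_left]
      by_cases hij : j = i
      · subst hij
        exact ((V j).inner_map_map z y).trans (hLL'.inner_eq hz hy)
      · exact hV hij z y
    rw [Submodule.mem_orthogonal]
    exact fun u hu => Submodule.mem_orthogonal_singleton_iff_inner_left.1 (hle hu)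

theorem exists_fundamentalSymmetry_of_grid {v : ℕ × ℤ → E} (hv : Orthonormal ℂ v)
    (hvtot : (Submodule.span ℂ (Set.range v))ᗮ = ⊥) {R : Submodule ℂ E}
    (hR : ∀ x ∈ R, ∀ i, ∃ C : ℝ, ∀ k, ‖⟪v (i, k), x⟫_ℂ‖ ≤ C * Real.exp (-8 * |(k : ℝ)|)) :
    ∃ J : E →L[ℂ] E, IsFundamentalSymmetry J ∧ ∀ x ∈ R, J x ∈ R → x = 0 := by
  classical
  have hcol : ∀ i, Orthonormal ℂ fun k => v (i, k) := fun i =>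
    hv.comp (fun k => (i, k)) fun k l h => congrArg Prod.snd h
  let G := MeasureTheory.Lp ℂ 2 (AddCircle.haarAddCircle (T := (1 : ℝ)))
  let V : ℕ → G →ₗᵢ[ℂ] E := fun i =>
    (hcol i).orthogonalFamily.linearIsometry.comp fourierBasis.repr.toLinearIsometry
  have hVb : ∀ i k, V i (fourierBasis k) = v (i, k) := fun i k => by
    change (hcol i).orthogonalFamily.linearIsometry (fourierBasis.repr (fourierBasis k)) = _
    rw [HilbertBasis.repr_self, OrthogonalFamily.linearIsometry_apply_single]
    simp
  have hzero : ∀ i (u : E), (∀ k, ⟪v (i, k), u⟫_ℂ = 0) → ∀ y, ⟪V i y, u⟫_ℂ = 0 := by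
    intro i u hu y
    have h1 : (V i).toContinuousLinearMap.adjoint u = 0 := by
      apply fourierBasis.repr.injective
      ext k
      rw [fourierBasis.repr_apply_apply, ContinuousLinearMap.adjoint_inner_right, map_zero]
      exact (congrArg (⟪·, u⟫_ℂ) (hVb i k)).trans (hu k)
    have h2 := ContinuousLinearMap.adjoint_inner_right (V i).toContinuousLinearMap y u
    rw [h1, inner_zero_right] at h2
    exact h2.symm
  have hV : OrthogonalFamily ℂ (fun _ => G) V := fun i j hij y z => by
    refine hzero i _ (fun k => inner_eq_zero_symm.1 (hzero j _ (fun l => ?_) z)) y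
    exact hv.2 fun h => hij (congrArg Prod.fst h).symm
  have hkill : ∀ A : Set UnitAddCircle, MeasurableSet A → (interior A).Nonempty → ∀ x ∈ R,
      (∀ i, ∀ y ∈ lpVanishingOn AddCircle.haarAddCircle Aᶜ, ⟪V i y, x⟫_ℂ = 0) → x = 0 := by
    intro A hA hAn x hx hy
    have hQ : ∀ i, (V i).toContinuousLinearMap.adjoint x = 0 := fun i => by
      obtain ⟨C, hC⟩ := hR x hx i
      refine fourierLp_eq_zero_of_ae_eq_zero_on_open (C := C) (fun k => ?_) isOpen_interior hAn ?_
      · rw [fourierBasis.repr_apply_apply, ContinuousLinearMap.adjoint_inner_right]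
        exact (congrArg (fun w => ‖⟪w, x⟫_ℂ‖) (hVb i k)).trans_le (hC k)
      · have h1 : (V i).toContinuousLinearMap.adjoint x ∈
            (lpVanishingOn AddCircle.haarAddCircle Aᶜ)ᗮ := fun y hyL => by
          rw [ContinuousLinearMap.adjoint_inner_right]
          exact hy i y hyL
        filter_upwards [mem_lpVanishingOn.1 (orthogonal_lpVanishingOn_compl_le hA h1)] with t ht hti
        exact ht (interior_subset hti)
    have hxo : x ∈ (Submodule.span ℂ (Set.range v))ᗮ := by
      rw [Submodule.mem_orthogonal]
      have hle : Submodule.span ℂ (Set.range v) ≤ (Submodule.span ℂ {x})ᗮ := by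
        rw [Submodule.span_le]
        rintro _ ⟨⟨i, k⟩, rfl⟩
        rw [SetLike.mem_coe, Submodule.mem_orthogonal_singleton_iff_inner_left, ← hVb]
        exact (ContinuousLinearMap.adjoint_inner_right (V i).toContinuousLinearMap _ x).symm.trans
          (by rw [hQ, inner_zero_right])
      exact fun u hu => Submodule.mem_orthogonal_singleton_iff_inner_left.1 (hle hu)
    rwa [hvtot, Submodule.mem_bot] at hxo
  -- Two distinct points give disjoint open sets `U` and `W`, so both `U` and `Uᶜ` have interior.
  have hab : ((1 / 2 : ℝ) : UnitAddCircle) ≠ 0 := fun h => by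
    obtain ⟨n, hn⟩ := AddCircle.coe_eq_zero_iff (1 : ℝ) |>.1 h
    rw [zsmul_one] at hn
    have h2 : ((2 * n : ℤ) : ℝ) = (1 : ℤ) := by push_cast; linarith
    have h3 : 2 * n = 1 := by exact_mod_cast h2
    omega
  obtain ⟨U, W, hU, hW, haU, hbW, hUW⟩ := t2_separation hab
  refine exists_fundamentalSymmetry_of_orthogonalFamily hV
    (lpVanishingOn_isOrtho_compl (A := U)).symm (hkill U hU.measurableSet ?_) ?_
  · exact ⟨_, by rwa [hU.interior_eq]⟩
  · have h1 := hkill Uᶜ hU.measurableSet.compl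
      ⟨0, interior_maximal hUW.subset_compl_left hW hbW⟩
    rwa [compl_compl] at h1

end ExistsSymmetry

theorem LinearPMap.IsFormalAdjoint.exists_fundamentalSymmetry_inf_eq_bot {E : Type*}
    [NormedAddCommGroup E] [InnerProductSpace ℂ E] [CompleteSpace E]
    [TopologicalSpace.SeparableSpace E] {H : E →ₗ.[ℂ] E}
    (hsymm : H.IsFormalAdjoint H) (hdense : Dense (H.domain : Set E))
    (hunb : IsUnboundedOperator H) :
    ∃ J : E →L[ℂ] E, IsFundamentalSymmetry J ∧ ∀ x ∈ H.domain, J x ∈ H.domain → x = 0 := by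
  obtain ⟨g, hg, hdecay⟩ := hsymm.exists_orthonormal_decay hdense hunb (Real.exp_pos (-8))
  obtain ⟨v, hv, hvtot, hvg⟩ := hg.exists_total_grid
  refine exists_fundamentalSymmetry_of_grid hv hvtot fun x hx i => ?_
  obtain ⟨C, hC⟩ := hdecay x hx
  have hC0 : 0 ≤ C := by simpa using (norm_nonneg _).trans (hC 0)
  -- The added term covers `k = 0`, where `v (i, 0)` need not come from `g`.
  refine ⟨C + ‖⟪v (i, 0), x⟫_ℂ‖, fun k => ?_⟩
  by_cases hk : k = 0
  · subst hk
    simp [hC0]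
  · obtain ⟨n, hn, hkn⟩ := hvg i k hk
    have hn' : |(k : ℝ)| ≤ n := by exact_mod_cast hn
    rw [hkn]
    calc _ ≤ C * Real.exp (-8) ^ n := hC n
      _ = C * Real.exp (-8 * n) := by rw [← Real.exp_nat_mul, mul_comm (n : ℝ)]
      _ ≤ (C + ‖⟪v (i, 0), x⟫_ℂ‖) * Real.exp (-8 * |(k : ℝ)|) := by
        refine mul_le_mul (le_add_of_nonneg_right (norm_nonneg _))
          (Real.exp_le_exp.2 (by linarith)) (Real.exp_pos _).le (by positivity)

theorem corollary3p18 {E : Type*} [NormedAddCommGroup E] [InnerProductSpace ℂ E]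
    [CompleteSpace E] [TopologicalSpace.SeparableSpace E]
    (H : E →ₗ.[ℂ] E) (hH : IsSelfAdjoint H) (hunb : IsUnboundedOperator H) :
    (∃ U : ℝ → (E →L[ℂ] E),
      Function.Injective U ∧
      (∀ t, U t ∈ unitary (E →L[ℂ] E)) ∧
      ∀ t, H.domain ⊓ (boundedSandwich (star (U t)) H (U t)).domain = ⊥) ∧
    (∃ J : ℝ → (E →L[ℂ] E),
      Function.Injective J ∧
      (∀ t, IsFundamentalSymmetry (J t)) ∧
      (∀ x : E, Continuous fun t => J t x) ∧
      ∀ t, H.domain ⊓ (boundedSandwich (J t) H (J t)).domain = ⊥) := by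
  have hdense := hH.dense_domain
  have hsymm : H.IsFormalAdjoint H := by
    have h := LinearPMap.adjoint_isFormalAdjoint hdense
    rwa [LinearPMap.isSelfAdjoint_def.1 hH] at h
  obtain ⟨J₀, hJ₀, hJ₀R⟩ := hsymm.exists_fundamentalSymmetry_inf_eq_bot hdense hunb
  obtain ⟨y, hy, -⟩ := hunb.exists_seq
  have hy0 : (y 0 : E) ≠ 0 := fun h => by
    have h1 := hy 0
    rw [(Subtype.ext h : y 0 = 0), H.map_zero, norm_zero] at h1
    exact zero_ne_one h1
  obtain ⟨J, hinj, hJ, hcont, hJR⟩ := exists_family_of_fundamentalSymmetry hJ₀ hJ₀R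
    (H.domain.smul_mem ((‖(y 0 : E)‖⁻¹ : ℝ) : ℂ) (y 0).2) (by
      rw [norm_smul, Complex.norm_real, norm_inv, norm_norm]
      exact inv_mul_cancel₀ (norm_ne_zero_iff.2 hy0))
  -- The domain does not depend on the left factor, so `J` also serves as `U`.
  have hbot : ∀ t (B : E →L[ℂ] E), H.domain ⊓ (boundedSandwich B H (J t)).domain = ⊥ :=
    fun t B => (Submodule.eq_bot_iff _).2 fun x hx => hJR t x hx.1 hx.2
  exact ⟨⟨J, hinj, fun t => (hJ t).2, fun t => hbot t _⟩,
    ⟨J, hinj, hJ, fun x => hcont.clm_apply continuous_const, fun t => hbot t _⟩⟩
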